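/- Let $R$ be a commutative $\mathbb C$-algebra, $\hbar\in R$ and $\mu\in R^\times$ (for instance $R=\mathbb C$ with scalars $\hbar$ and $\mu\neq 0$, or $R=\mathbb C[\mu,\mu^{-1}]$ with $\mu$ a formal parameter and $\hbar=\mu$). Let $[z_1:z_2:\pi_1:\pi_2]$ be the homogeneous coordinates of $\mathbb{CP}^3$ (twistor space; on the correspondence space $\mathbb C^4\times\mathbb{CP}^1$ they are $z_1=x^{\alpha\dot 1}\pi_\alpha$, $z_2=x^{\alpha\dot 2}\pi_\alpha$ and $\pi_1,\pi_2$), and write $z^{\dot 1}=z_1$, $z^{\dot 2}=z_2$, $Z=(Z_1,\dots,Z_4)=(z_1,z_2,\pi_1,\pi_2)$. Let $D=(D^{\alpha\dot\alpha,\beta\dot\beta})$ be a skew-symmetric complex $4\times 4$ matrix, and let $\hat\Lambda$ be the $4\times4$ matrix with $\hat\Lambda^{\dot\alpha\dot\beta}=\sum_{\alpha,\beta}D^{\alpha\dot\alpha,\beta\dot\beta}\pi_\alpha\pi_\beta$ in the directions $z^{\dot\alpha},z^{\dot\beta}$ and all other entries zero. For $f,g\in R[z_1,z_2,\pi_1,\pi_2]$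 put $$f\# g=\sum_{r\ge 0}\frac1{r!}\Big(\frac{\hbar}{2}\Big)^r\sum_{i_1,j_1,\dots,i_r,j_r}\hat\Lambda^{i_1j_1}\cdots\hat\Lambda^{i_rj_r}\;\partial_{Z_{i_1}}\cdots\partial_{Z_{i_r}}f\;\,\partial_{Z_{j_1}}\cdots\partial_{Z_{j_r}}g .$$ Let $A[Z]$ be a homogeneous polynomial of degree $2$ in $z_1,z_2$ with complex coefficients, and let $e_\#^{tA[Z]/\mu}=\sum_{n\ge0}\frac{t^n}{n!}\big(A[Z]/\mu\big)^{\# n}$ for $t\in\mathbb C$, understood as a formal sum of its homogeneous components. Then: 1. $\#$ is a biadditive associative product with unit $1$. It adds degrees, i.e. maps homogeneous polynomials of degrees $a$ and $b$ to a homogeneous polynomial of degree $a+b$. It satisfies $[z^{\dot\alpha},z^{\dot\beta}]_\#=\hbar\sum_{\alpha,\beta}D^{\alpha\dot\alpha,\beta\dot\beta}\pi_\alpha\pi_\beta$ and $\pi_\alpha\# f=f\#\pi_\alpha=\pi_\alpha f$ for all $f$. 2. $(A[Z]/\mu)^{\#n}$ is homogeneous of degree $2n$, so that each homogeneous component of $e_\#^{tA[Z]/\mu}$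 is a finite sum. The formal sum $F(t)=e_\#^{tA[Z]/\mu}$ satisfies $\partial_tF=\frac1\mu A[Z]\#F$ and $F(0)=1$, in each degree and for each coefficient (the derivative of an $R$-valued function being taken after applying an arbitrary $\mathbb C$-linear functional $R\to\mathbb C$). 3. The sharp exponential $e_\#^{A[Z]/\mu}$ defines a cohomology class of $\mathbb{CP}^3$ with coefficients in the sheaf of formal sums of sections of the sheaves $\mathcal O_{\mathbb{CP}^3}(k)$, $k\ge0$: there is exactly one class $$c\in H^0\Big(\mathbb{CP}^3,\ \prod_{k\ge0}\mathcal O_{\mathbb{CP}^3}(k)\otimes_{\mathbb C}R\Big)$$ such that for every $k\ge 0$ its component in $H^0(\mathbb{CP}^3,\mathcal O_{\mathbb{CP}^3}(k)\otimes_{\mathbb C}R)$ is the section given by the degree-$k$ homogeneous component of $e_\#^{A[Z]/\mu}$. Here $\mathcal O_{\mathbb{CP}^3}(k)$ is the sheaf whose sections over an open $U$ are the holomorphic functions, homogeneous of degree $k$, on the cone over $U$ in $\mathbb C^4\setminus\{0\}$. -/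

import Mathlib

open CategoryTheory CategoryTheory.Limits Opposite TopologicalSpace

noncomputable section

namespace SharpTwistor

/-! ### Complex projective space and the sheaves `𝒪(k) ⊗ R` -/

/-- Homogeneous coordinate vectors `(z₁, z₂, π₁, π₂)`. -/
abbrev Vec : Type := Fin 4 → ℂ

/-- The set of points of complex projective three-space. -/
abbrev Pt : Type := Projectivization ℂ Vec

/-- The quotient topology coming from `ℂ⁴ ∖ {0}`. -/
instance instTopPt : TopologicalSpace Pt :=
  TopologicalSpace.coinduced (fun v : {v : Vec // v ≠ 0} => Projectivization.mk ℂ v.1 v.2)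
    inferInstance

/-- Complex projective three-space with its usual (analytic) topology. -/
abbrev CP3 : TopCat := TopCat.of Pt

/-- The punctured line over a point: all nonzero vectors that represent it. -/
abbrev Line (p : CP3) : Type := {v : Vec // ∃ h : v ≠ 0, Projectivization.mk ℂ v h = p}

/-- Rescaling a representative by a nonzero complex number. -/
def Line.scale {p : CP3} (c : ℂˣ) (v : Line p) : Line p :=
  ⟨(c : ℂ) • v.1, smul_ne_zero c.ne_zero v.2.1, by
    obtain ⟨v, h, rfl⟩ := v
    exact (Projectivization.mk_eq_mk_iff ℂ _ _ _ h).2 ⟨c, rfl⟩⟩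

/-- The open cone in `ℂ⁴ ∖ {0}` over a set of points of projective space. -/
def cone (U : Opens CP3) : Set Vec := {v | ∃ h : v ≠ 0, (Projectivization.mk ℂ v h : CP3) ∈ U}

variable (R : Type) [CommRing R] [Algebra ℂ R]

/-- Sections of `𝒪(k) ⊗_ℂ R` of the simplest kind: `R`-valued functions on the cone over `U`,
homogeneous of degree `k`, that are a finite sum `∑ hᵢ • rᵢ` with holomorphic `hᵢ` and `rᵢ ∈ R`.
A section over `U` is recorded as a family of functions on the punctured lines over `U`. -/
def twistPrelocal (k : ℤ) : TopCat.PrelocalPredicate (X := CP3) (fun p => Line p → R) where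
  pred {U} f :=
    (∀ (p : U) (c : ℂˣ) (v : Line p.1), f p (v.scale c) = ((c : ℂ) ^ k) • f p v) ∧
    ∃ (n : ℕ) (h : Fin n → Vec → ℂ) (r : Fin n → R),
      (∀ i, DifferentiableOn ℂ (h i) (cone U)) ∧
      ∀ (p : U) (v : Line p.1), f p v = ∑ i, h i v.1 • r i
  res {U V} i f := by
    rintro ⟨hf, n, h, r, hh, hs⟩
    exact ⟨fun p => hf ⟨p.1, i.le p.2⟩, n, h, r,
      fun j => (hh j).mono (fun v hv => ⟨hv.1, i.le hv.2⟩), fun p => hs ⟨p.1, i.le p.2⟩⟩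

/-- Sections of `𝒪(k) ⊗_ℂ R`: those that locally have the form above. -/
def twistLocal (k : ℤ) : TopCat.LocalPredicate (X := CP3) (fun p => Line p → R) :=
  (twistPrelocal R k).sheafify

lemma twistPrelocal_zero (k : ℤ) (U : Opens CP3) :
    (twistPrelocal R k).pred (U := U) (fun _ => 0) :=
  ⟨fun _ _ _ => by simp, 0, Fin.elim0, Fin.elim0, fun i => i.elim0, fun _ _ => by simp⟩

lemma twistPrelocal_add (k : ℤ) {U : Opens CP3} {f g : ∀ p : U, Line p.1 → R}
    (hf : (twistPrelocal R k).pred f) (hg : (twistPrelocal R k).pred g) :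
    (twistPrelocal R k).pred (fun p => f p + g p) := by
  obtain ⟨hf, n, h, r, hh, hs⟩ := hf
  obtain ⟨hg, n', h', r', hh', hs'⟩ := hg
  refine ⟨fun p c v => by simp [hf, hg], n + n', Fin.append h h', Fin.append r r', ?_, ?_⟩
  · intro i
    induction i using Fin.addCases with
    | left i => simpa using hh i
    | right i => simpa using hh' i
  · intro p v
    simp [Fin.sum_univ_add, hs, hs']

lemma twistPrelocal_neg (k : ℤ) {U : Opens CP3} {f : ∀ p : U, Line p.1 → R}
    (hf : (twistPrelocal R k).pred f) : (twistPrelocal R k).pred (fun p => -f p) := by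
  obtain ⟨hf, n, h, r, hh, hs⟩ := hf
  exact ⟨fun p c v => by simp [hf], n, h, fun i => -r i, hh, fun p v => by simp [hs]⟩

/-- The additive group of sections of `𝒪(k) ⊗_ℂ R` over an open set. -/
def twistSections (k : ℤ) (U : Opens CP3) : AddSubgroup (∀ p : U, Line p.1 → R) where
  carrier := {f | (twistLocal R k).pred f}
  zero_mem' := TopCat.PrelocalPredicate.sheafifyOf (twistPrelocal_zero R k U)
  add_mem' {f g} hf hg x := by
    obtain ⟨V, m, i, h⟩ := hf x
    obtain ⟨V', m', i', h'⟩ := hg x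
    exact ⟨V ⊓ V', ⟨m, m'⟩, V.infLELeft V' ≫ i,
      twistPrelocal_add R k ((twistPrelocal R k).res (V.infLELeft V') _ h)
        ((twistPrelocal R k).res (V.infLERight V') _ h')⟩
  neg_mem' {f} hf x := by
    obtain ⟨V, m, i, h⟩ := hf x
    exact ⟨V, m, i, twistPrelocal_neg R k h⟩

/-- The presheaf of abelian groups of sections of `𝒪(k) ⊗_ℂ R`, with the usual restriction. -/
def twistPresheaf (k : ℤ) : TopCat.Presheaf AddCommGrpCat.{0} CP3 where
  obj U := AddCommGrpCat.of (twistSections R k U.unop)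
  map {U V} i := AddCommGrpCat.ofHom
    { toFun := fun f => ⟨fun p => f.1 ⟨p.1, i.unop.le p.2⟩, (twistLocal R k).res i.unop f.1 f.2⟩
      map_zero' := rfl
      map_add' := fun _ _ => rfl }

/-- Forgetting the addition gives the sheaf of functions satisfying the local predicate. -/
def twistPresheafCompForget (k : ℤ) :
    twistPresheaf R k ⋙ CategoryTheory.forget AddCommGrpCat ≅
      (TopCat.subsheafToTypes (twistLocal R k)).1 :=
  NatIso.ofComponents fun _ => Iso.refl _

/-- The sheaf `𝒪(k) ⊗_ℂ R` on complex projective three-space; for `R = ℂ` it is `𝒪(k)`, and for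
`R = ℂ[μ, μ⁻¹]` it is `𝒪(k)[μ, μ⁻¹]`. -/
def twist (k : ℤ) : TopCat.Sheaf AddCommGrpCat.{0} CP3 :=
  ⟨twistPresheaf R k, (TopCat.Presheaf.isSheaf_iff_isSheaf_comp
    (CategoryTheory.forget AddCommGrpCat) _).mpr
      (TopCat.Presheaf.isSheaf_of_iso (twistPresheafCompForget R k).symm
        (TopCat.subsheafToTypes (twistLocal R k)).property)⟩

/-- The sheaf of formal (infinite) sums `∑_{k ≥ 0} f_k` with `f_k` in `𝒪(k) ⊗_ℂ R`. -/
def coeffSheaf : TopCat.Sheaf AddCommGrpCat.{0} CP3 := ∏ᶜ fun k : ℕ => twist R (k : ℤ)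

/-- The sheaf morphism that takes the component of degree `k` of a formal sum. -/
def coeffProj (k : ℕ) : coeffSheaf R ⟶ twist R (k : ℤ) := Pi.π (fun k : ℕ => twist R (k : ℤ)) k

variable {R}

/-- The global section of `𝒪(k) ⊗_ℂ R` that corresponds to a class in `H⁰`. -/
def globalSection {k : ℤ} (c : Sheaf.H (twist R k) 0) : twistSections R k ⊤ :=
  Sheaf.H.equiv₀ (twist R k) isTerminalTop c

/-- The value of a class in `H⁰(ℂP³, 𝒪(k) ⊗_ℂ R)` at a nonzero vector of homogeneous
coordinates. -/
def classValue {k : ℤ} (c : Sheaf.H (twist R k) 0) (v : Vec) (hv : v ≠ 0) : R :=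
  (globalSection c).1 ⟨Projectivization.mk ℂ v hv, trivial⟩ ⟨v, hv, rfl⟩

/-! ### The sharp product and the sharp exponential -/

/-- Polynomials in the homogeneous coordinates `(z₁, z₂, π₁, π₂)`. -/
abbrev Poly (R : Type) [CommRing R] : Type := MvPolynomial (Fin 4) R

/-- The coordinate `z^α̇`. -/
def zc (R : Type) [CommRing R] (a : Fin 2) : Poly R := MvPolynomial.X (Fin.castAdd 2 a)

/-- The coordinate `π_α`. -/
def pic (R : Type) [CommRing R] (α : Fin 2) : Poly R := MvPolynomial.X (Fin.natAdd 2 α)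

/-- The iterated partial derivative `∂_{α₁} ⋯ ∂_{α_r} f`. -/
def pderivs {r : ℕ} (α : Fin r → Fin 4) (f : Poly R) : Poly R :=
  (List.ofFn α).foldr (fun i g => MvPolynomial.pderiv i g) f

/-- The product `∑_r (1/r!) (ħ/2)^r Λ^{α₁β₁} ⋯ Λ^{α_rβ_r} ∂_{α₁} ⋯ ∂_{α_r} f · ∂_{β₁} ⋯ ∂_{β_r} g`.
The terms with `r` larger than the degree of `f` vanish. -/
def starMul (ħ : R) (Λ : Matrix (Fin 4) (Fin 4) (Poly R)) (f g : Poly R) : Poly R :=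
  ∑ᶠ r : ℕ, (((r.factorial : ℂ) * 2 ^ r)⁻¹ • MvPolynomial.C (ħ ^ r)) *
    ∑ α : Fin r → Fin 4, ∑ β : Fin r → Fin 4,
      (∏ i, Λ (α i) (β i)) * pderivs α f * pderivs β g

/-- The quadratic form `D^{αα̇,ββ̇} π_α π_β` in `π`, for fixed dotted indices. -/
def piForm (R : Type) [CommRing R] [Algebra ℂ R]
    (D : Matrix (Fin 2 × Fin 2) (Fin 2 × Fin 2) ℂ) (a b : Fin 2) : Poly R :=
  ∑ α, ∑ β, MvPolynomial.C (algebraMap ℂ R (D (α, a) (β, b))) * pic R α * pic R β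

/-- The bivector with components `D^{αα̇,ββ̇} π_α π_β` in the directions `z^α̇, z^β̇` and zero in all
directions that involve `π`. -/
def lambdaHat (R : Type) [CommRing R] [Algebra ℂ R]
    (D : Matrix (Fin 2 × Fin 2) (Fin 2 × Fin 2) ℂ) : Matrix (Fin 4) (Fin 4) (Poly R) :=
  Matrix.of fun i j =>
    Fin.addCases (m := 2) (n := 2) (motive := fun _ => Poly R)
      (fun a => Fin.addCases (m := 2) (n := 2) (motive := fun _ => Poly R)
        (fun b => piForm R D a b) (fun _ => 0) j)
      (fun _ => 0) i

/-- The sharp product `f # g`. -/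
def sharp (ħ : R) (D : Matrix (Fin 2 × Fin 2) (Fin 2 × Fin 2) ℂ) (f g : Poly R) : Poly R :=
  starMul ħ (lambdaHat R D) f g

/-- The sharp power `f # f # ⋯ # f`. -/
def sharpPow (ħ : R) (D : Matrix (Fin 2 × Fin 2) (Fin 2 × Fin 2) ℂ) (f : Poly R) : ℕ → Poly R
  | 0 => 1
  | n + 1 => sharp ħ D f (sharpPow ħ D f n)

/-- The component of degree `k` of the sharp exponential `e_#^{tf} = ∑_n (tⁿ/n!) f^{#n}`. -/
def sharpExp (ħ : R) (D : Matrix (Fin 2 × Fin 2) (Fin 2 × Fin 2) ℂ) (f : Poly R) (t : ℂ)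
    (k : ℕ) : Poly R :=
  ∑ᶠ n : ℕ, (t ^ n / (n.factorial : ℂ)) •
    MvPolynomial.homogeneousComponent k (sharpPow ħ D f n)

/-- The polynomial `μ⁻¹ A[Z]` where `A` is a polynomial in `z₁, z₂` alone. -/
def scaledSymbol (μ : Rˣ) (A : MvPolynomial (Fin 2) ℂ) : Poly R :=
  MvPolynomial.C ((μ⁻¹ : Rˣ) : R) *
    MvPolynomial.rename (Fin.castAdd 2) (MvPolynomial.map (algebraMap ℂ R) A)

end SharpTwistor

end

noncomputable section

namespace SharpTwistor

open MvPolynomial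

/-! ### Contractions with the bivector in the `z` directions. -/

section Bidiff

variable {R : Type} [CommRing R]

/-! The entries of the bivector depend on `π` only, and it differentiates in `z` only. So `#` is a
Moyal product with constant coefficients over the ring of Casimirs, and each `∂_z` is a derivation
of it (`dz_sharp`). Left multiplication by `z_a` is the operator `z_a + (ħ/2) ∑ P_ab ∂_b`
(`sharp_zc`), where `P_ab` is `piForm`. Associativity is proved on generators: the left factors that
associate with everything contain the `z_a` and the Casimirs and are closed under sums and `#`, and
`z_a f = z_a # f - (ħ/2) ∑ P_ab ∂_b f` gives every monomial by induction on the degree. A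
contraction removes one degree from each factor and restores two through `P_ab`, so degrees add.
Hence the component of degree `2n` of the exponential is a single term `tⁿ/n! f^{#n}`, and the
differential equation is checked term by term. Each component is a homogeneous polynomial, hence a
global section. Since `H⁰` is a `Hom` group, it turns the product of sheaves into families of
classes (`existsUnique_H_pi`). -/

lemma pderiv_comm {σ : Type*} (i j : σ) (f : MvPolynomial σ R) :
    pderiv i (pderiv j f) = pderiv j (pderiv i f) := by
  classical
  rcases eq_or_ne i j with rfl | h
  · rfl
  ext m
  simp only [coeff_pderiv, add_right_comm m, Finsupp.add_apply, Finsupp.single_eq_of_ne h,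
    Finsupp.single_eq_of_ne h.symm, add_zero]
  ring

/-- The partial derivative in the direction `z^α̇`. -/
def dz (a : Fin 2) : Derivation R (Poly R) (Poly R) := pderiv (Fin.castAdd 2 a)

lemma dz_mul (a : Fin 2) (f g : Poly R) : dz a (f * g) = dz a f * g + f * dz a g := by
  simp only [dz, pderiv_mul]

lemma dz_comm (a b : Fin 2) (f : Poly R) : dz a (dz b f) = dz b (dz a f) :=
  pderiv_comm _ _ f

lemma dz_zc (a b : Fin 2) : dz a (zc R b) = if a = b then 1 else 0 := by
  classical
  by_cases h : a = b
  · simp [dz, zc, h]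
  · simp only [dz, zc, h, if_false]
    exact pderiv_X_of_ne fun e => h (Fin.castAdd_injective 2 2 e).symm

lemma dz_pic (a α : Fin 2) : dz a (pic R α) = 0 :=
  pderiv_X_of_ne fun e => by
    have := congrArg Fin.val e
    simp at this
    omega

lemma dz_C (a : Fin 2) (c : R) : dz a (C c : Poly R) = 0 := pderiv_C

/-- Polynomials annihilated by the derivatives in the `z` directions. -/
def IsCasimir (c : Poly R) : Prop := ∀ a, dz a c = 0

lemma isCasimir_C (c : R) : IsCasimir (C c) := fun a => dz_C a c

lemma isCasimir_pic (α : Fin 2) : IsCasimir (pic R α) := fun a => dz_pic a α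

lemma IsCasimir.mul {c d : Poly R} (hc : IsCasimir c) (hd : IsCasimir d) : IsCasimir (c * d) :=
  fun a => by rw [dz_mul, hc a, hd a]; simp

lemma IsCasimir.sum {ι : Type*} {s : Finset ι} {c : ι → Poly R} (hc : ∀ i, IsCasimir (c i)) :
    IsCasimir (∑ i ∈ s, c i) :=
  fun a => by rw [map_sum]; exact Finset.sum_eq_zero fun i _ => hc i a

/-- `foldr` applies the last index first. Splitting off the last index therefore matches the
recursion of `bidiff`, which differentiates the arguments before recursing. -/
lemma pderivs_snoc {r : ℕ} (α : Fin r → Fin 4) (i : Fin 4) (f : Poly R) :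
    pderivs (Fin.snoc α i : Fin (r + 1) → Fin 4) f = pderivs α (pderiv i f) := by
  rw [pderivs, List.ofFn_succ']
  simp [pderivs]

lemma sum_snoc {M : Type*} [AddCommMonoid M] {r : ℕ} (F : (Fin (r + 1) → Fin 4) → M) :
    ∑ α, F α = ∑ i, ∑ α : Fin r → Fin 4, F (Fin.snoc α i) := by
  rw [← Fintype.sum_prod_type',
    ← (Fin.snocEquiv (n := r) fun _ => Fin 4).sum_comp]
  rfl

variable [Algebra ℂ R] (ħ : R) (D : Matrix (Fin 2 × Fin 2) (Fin 2 × Fin 2) ℂ)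

lemma isCasimir_piForm (a b : Fin 2) : IsCasimir (piForm R D a b) :=
  .sum fun _ => .sum fun _ => ((isCasimir_C _).mul (isCasimir_pic _)).mul (isCasimir_pic _)

lemma isHomogeneous_piForm (a b : Fin 2) : (piForm R D a b).IsHomogeneous 2 :=
  .sum _ _ _ fun _ _ => .sum _ _ _ fun _ _ => by
    simpa [pic] using
      ((isHomogeneous_C (Fin 4) _).mul (isHomogeneous_X _ _)).mul (isHomogeneous_X _ _)

/-- The bidifferential operator `Λ^{α₁β₁} ⋯ Λ^{α_rβ_r} ∂_{α₁} ⋯ ∂_{α_r} f · ∂_{β₁} ⋯ ∂_{β_r} g`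
of the bivector `lambdaHat`. -/
def bidiff : ℕ → Poly R → Poly R → Poly R
  | 0, f, g => f * g
  | r + 1, f, g => ∑ a, ∑ b, piForm R D a b * bidiff r (dz a f) (dz b g)

lemma lambdaHat_sum (F : Fin 4 → Fin 4 → Poly R) :
    ∑ i, ∑ j, lambdaHat R D i j * F i j =
      ∑ a, ∑ b, piForm R D a b * F (Fin.castAdd 2 a) (Fin.castAdd 2 b) := by
  rw [Fin.sum_univ_add (a := 2) (b := 2)]
  simp only [Fin.sum_univ_add (a := 2) (b := 2)]
  simp only [lambdaHat, Matrix.of_apply, Fin.addCases_left, Fin.addCases_right]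
  simp

lemma sum_pderivs_eq_bidiff (r : ℕ) (f g : Poly R) :
    ∑ α : Fin r → Fin 4, ∑ β : Fin r → Fin 4,
      (∏ i, lambdaHat R D (α i) (β i)) * pderivs α f * pderivs β g = bidiff D r f g := by
  induction r generalizing f g with
  | zero => simp [bidiff, pderivs]
  | succ r ih =>
    rw [sum_snoc]
    simp only [sum_snoc, pderivs_snoc, Fin.prod_univ_castSucc, Fin.snoc_castSucc, Fin.snoc_last]
    rw [bidiff]
    have := lambdaHat_sum D fun i j => bidiff D r (pderiv i f) (pderiv j g)
    simp only [dz]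
    rw [← this]
    refine Finset.sum_congr rfl fun i _ => ?_
    rw [Finset.sum_comm]
    refine Finset.sum_congr rfl fun j _ => ?_
    rw [← ih, Finset.mul_sum]
    refine Finset.sum_congr rfl fun α _ => ?_
    rw [Finset.mul_sum]
    refine Finset.sum_congr rfl fun β _ => ?_
    ring

variable {D} in
lemma bidiff_add_left (r : ℕ) (f f' g : Poly R) :
    bidiff D r (f + f') g = bidiff D r f g + bidiff D r f' g := by
  induction r generalizing f f' g with
  | zero => exact add_mul _ _ _
  | succ r ih => simp only [bidiff, map_add, ih, mul_add, Finset.sum_add_distrib]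

variable {D} in
lemma bidiff_add_right (r : ℕ) (f g g' : Poly R) :
    bidiff D r f (g + g') = bidiff D r f g + bidiff D r f g' := by
  induction r generalizing f g g' with
  | zero => exact mul_add _ _ _
  | succ r ih => simp only [bidiff, map_add, ih, mul_add, Finset.sum_add_distrib]

variable {D} in
lemma bidiff_casimir_mul_left {c : Poly R} (hc : IsCasimir c) (r : ℕ) (f g : Poly R) :
    bidiff D r (c * f) g = c * bidiff D r f g := by
  induction r generalizing f g with
  | zero => exact mul_assoc _ _ _
  | succ r ih =>
    simp only [bidiff, dz_mul, hc _, zero_mul, zero_add, ih, Finset.mul_sum]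
    exact Finset.sum_congr rfl fun _ _ => Finset.sum_congr rfl fun _ _ => mul_left_comm _ _ _

variable {D} in
lemma bidiff_casimir_mul_right {c : Poly R} (hc : IsCasimir c) (r : ℕ) (f g : Poly R) :
    bidiff D r f (c * g) = c * bidiff D r f g := by
  induction r generalizing f g with
  | zero => exact mul_left_comm _ _ _
  | succ r ih =>
    simp only [bidiff, dz_mul, hc _, zero_mul, zero_add, ih, Finset.mul_sum]
    exact Finset.sum_congr rfl fun _ _ => Finset.sum_congr rfl fun _ _ => mul_left_comm _ _ _

variable {D} in
@[simp] lemma bidiff_zero_left (r : ℕ) (g : Poly R) : bidiff D r 0 g = 0 := by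
  simpa using bidiff_casimir_mul_left (D := D) (isCasimir_C (0 : R)) r 0 g

variable {D} in
@[simp] lemma bidiff_zero_right (r : ℕ) (f : Poly R) : bidiff D r f 0 = 0 := by
  simpa using bidiff_casimir_mul_right (D := D) (isCasimir_C (0 : R)) r f 0

lemma dz_bidiff (c : Fin 2) (r : ℕ) (f g : Poly R) :
    dz c (bidiff D r f g) = bidiff D r (dz c f) g + bidiff D r f (dz c g) := by
  induction r generalizing f g with
  | zero => exact dz_mul _ _ _
  | succ r ih =>
    simp only [bidiff, map_sum, dz_mul, isCasimir_piForm D _ _ c, ih, zero_mul, zero_add, mul_add,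
      Finset.sum_add_distrib, dz_comm c]

/-- At most one of the `r + 1` derivatives can hit `z_a`, and by symmetry of the contractions each
choice contributes the same sum. -/
lemma bidiff_zc_mul (a : Fin 2) (r : ℕ) (f g : Poly R) :
    bidiff D (r + 1) (zc R a * f) g = zc R a * bidiff D (r + 1) f g +
      (r + 1) * ∑ b, piForm R D a b * bidiff D r f (dz b g) := by
  induction r generalizing f g with
  | zero =>
    fin_cases a <;> simp [bidiff, dz_zc] <;> ring
  | succ r ih =>
    -- Contractions commute: the one that absorbed `z_a` may be moved to the outside.
    have key : ∑ c, ∑ b, piForm R D c b * ∑ b', piForm R D a b' *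
          bidiff D r (dz c f) (dz b' (dz b g)) =
        ∑ b, piForm R D a b * bidiff D (r + 1) f (dz b g) := by
      simp only [bidiff, Finset.mul_sum]
      symm
      rw [Finset.sum_comm]
      refine Finset.sum_congr rfl fun c _ => ?_
      rw [Finset.sum_comm]
      refine Finset.sum_congr rfl fun b _ => Finset.sum_congr rfl fun b' _ => ?_
      rw [dz_comm b b', mul_left_comm]
    -- The outermost derivative hits either `z_a`, which gives the first sum, or `f`. The induction
    -- hypothesis and `key` turn the latter into `r + 1` further copies.
    have h1 : bidiff D (r + 1 + 1) (zc R a * f) g =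
        (∑ b, piForm R D a b * bidiff D (r + 1) f (dz b g)) +
          ∑ c, ∑ b, piForm R D c b * bidiff D (r + 1) (zc R a * dz c f) (dz b g) := by
      conv_lhs => rw [bidiff]
      simp only [dz_mul, dz_zc, bidiff_add_left, mul_add, Finset.sum_add_distrib]
      refine congrArg (· + _) ?_
      rw [Finset.sum_eq_single a (fun c _ hc => by simp [hc]) (by simp)]
      simp
    rw [h1]
    simp only [ih, mul_add, Finset.sum_add_distrib]
    have h2 : ∀ c b : Fin 2, piForm R D c b * (((r : Poly R) + 1) * ∑ b', piForm R D a b' *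
          bidiff D r (dz c f) (dz b' (dz b g))) = (r + 1) * (piForm R D c b *
            ∑ b', piForm R D a b' * bidiff D r (dz c f) (dz b' (dz b g))) :=
      fun _ _ => mul_left_comm _ _ _
    simp only [h2, ← Finset.mul_sum, key]
    rw [show bidiff D (r + 1 + 1) f g = ∑ c, ∑ b, piForm R D c b *
      bidiff D (r + 1) (dz c f) (dz b g) from rfl]
    simp only [mul_left_comm (piForm R D _ _) (zc R a), ← Finset.mul_sum]
    push_cast
    ring

/-- The bound is uniform in `g`, so that one truncation serves `g` and its derivatives together. A
factor `z_a` raises it by at most one. -/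
lemma exists_bidiff_eq_zero (f : Poly R) : ∃ N, ∀ r ≥ N, ∀ g, bidiff D r f g = 0 := by
  induction f using MvPolynomial.induction_on with
  | C c =>
    refine ⟨1, fun r hr g => ?_⟩
    obtain ⟨r, rfl⟩ := Nat.exists_eq_add_of_le' hr
    simp [bidiff]
  | add f f' hf hf' =>
    obtain ⟨N, hN⟩ := hf
    obtain ⟨N', hN'⟩ := hf'
    refine ⟨max N N', fun r hr g => ?_⟩
    rw [bidiff_add_left, hN r (le_of_max_le_left hr), hN' r (le_of_max_le_right hr), add_zero]
  | mul_X f i hf =>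
    obtain ⟨N, hN⟩ := hf
    refine ⟨N + 1, fun r hr g => ?_⟩
    obtain ⟨r, rfl⟩ := Nat.exists_eq_add_of_le' (le_of_add_le_right hr)
    rw [mul_comm]
    induction i using Fin.addCases (m := 2) (n := 2) with
    | left a =>
      have := bidiff_zc_mul D a r f g
      rw [zc] at this
      rw [this, hN _ (by omega)]
      simp [hN r (by omega)]
    | right α =>
      have := bidiff_casimir_mul_left (D := D) (isCasimir_pic (R := R) α) (r + 1) f g
      rw [pic] at this
      rw [this, hN _ (by omega), mul_zero]

lemma isHomogeneous_bidiff (r : ℕ) {a b : ℕ} {f g : Poly R} (hf : f.IsHomogeneous a)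
    (hg : g.IsHomogeneous b) : (bidiff D r f g).IsHomogeneous (a + b) := by
  have hzero : ∀ {h : Poly R} (c : Fin 2), h.IsHomogeneous 0 → dz c h = 0 := fun c hh => by
    rw [← totalDegree_zero_iff_isHomogeneous, totalDegree_eq_zero_iff_eq_C] at hh
    rw [hh, dz_C]
  induction r generalizing a b f g with
  | zero => exact hf.mul hg
  | succ r ih =>
    refine .sum _ _ _ fun c _ => .sum _ _ _ fun d _ => ?_
    -- In degree zero the derivative vanishes; this case is separate because `0 - 1 = 0` would spoil
    -- the degree count.
    rcases a with _ | a
    · simp [hzero c hf, isHomogeneous_zero]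
    rcases b with _ | b
    · simp [hzero d hg, isHomogeneous_zero]
    have := (isHomogeneous_piForm (R := R) D c d).mul
      (ih (hf.pderiv (i := Fin.castAdd 2 c)) (hg.pderiv (i := Fin.castAdd 2 d)))
    rwa [show 2 + (a + 1 - 1 + (b + 1 - 1)) = a + 1 + (b + 1) by omega] at this

end Bidiff

/-! ### The sharp product, its associativity and its exponential. -/

section Sharp

variable {R : Type} [CommRing R] [Algebra ℂ R] (ħ : R)
  (D : Matrix (Fin 2 × Fin 2) (Fin 2 × Fin 2) ℂ)

/-- The coefficient `(1/r!) (ħ/2)^r` of the sharp product. -/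
def sharpCoeff (r : ℕ) : Poly R := ((r.factorial : ℂ) * 2 ^ r)⁻¹ • C (ħ ^ r)

/-- The constant `ħ/2`. -/
def halfHbar : Poly R := (2 : ℂ)⁻¹ • C ħ

lemma smul_eq_C_mul (c : ℂ) (f : Poly R) : c • f = C (algebraMap ℂ R c) * f := by
  rw [← MvPolynomial.smul_eq_C_mul, algebraMap_smul]

lemma smul_C_eq (c : ℂ) (x : R) : (c • C x : Poly R) = C (c • x) := by
  rw [smul_eq_C_mul, ← C_mul, Algebra.smul_def]

lemma sharpCoeff_eq_C (r : ℕ) :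
    sharpCoeff ħ r = C (((r.factorial : ℂ) * 2 ^ r)⁻¹ • ħ ^ r) := smul_C_eq _ _

lemma isCasimir_halfHbar : IsCasimir (halfHbar ħ) := by
  rw [halfHbar, smul_C_eq]
  exact isCasimir_C _

lemma sharpCoeff_zero : sharpCoeff ħ 0 = 1 := by simp [sharpCoeff]

/-- The factor `r + 1` is the multiplicity in `bidiff_zc_mul`; absorbing it lowers the order of the
coefficient by one. -/
lemma sharpCoeff_succ (r : ℕ) :
    sharpCoeff ħ (r + 1) * (r + 1) = sharpCoeff ħ r * halfHbar ħ := by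
  have h : ((r : Poly R) + 1) = C (algebraMap ℂ R (r + 1)) := by simp
  have h1 : ((r : ℂ) + 1) ≠ 0 := Nat.cast_add_one_ne_zero r
  have h2 : (r.factorial : ℂ) ≠ 0 := Nat.cast_ne_zero.2 r.factorial_ne_zero
  rw [h, sharpCoeff_eq_C, sharpCoeff_eq_C, halfHbar, smul_C_eq, ← C_mul, ← C_mul]
  congr 1
  simp only [Algebra.smul_def]
  rw [mul_right_comm, ← map_mul, mul_mul_mul_comm, ← map_mul, ← pow_succ]
  congr 2
  rw [Nat.factorial_succ]
  push_cast
  field_simp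
  ring

lemma two_mul_halfHbar : 2 * halfHbar ħ = C ħ := by
  rw [two_mul, halfHbar, ← add_smul]
  norm_num

lemma sharp_eq_finsum (f g : Poly R) :
    sharp ħ D f g = ∑ᶠ r : ℕ, sharpCoeff ħ r * bidiff D r f g := by
  simp only [sharp, starMul, sum_pderivs_eq_bidiff]
  rfl

lemma hasFiniteSupport_sharp (f g : Poly R) :
    (Function.support fun r : ℕ => sharpCoeff ħ r * bidiff D r f g).Finite := by
  obtain ⟨N, hN⟩ := exists_bidiff_eq_zero D f
  refine (Set.finite_lt_nat N).subset fun r hr => ?_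
  by_contra h
  exact hr (by simp [hN r (not_lt.1 h)])

variable {ħ D}

lemma sharp_eq_sum {f : Poly R} {N : ℕ} (hN : ∀ r ≥ N, ∀ g, bidiff D r f g = 0) (g : Poly R) :
    sharp ħ D f g = ∑ r ∈ Finset.range N, sharpCoeff ħ r * bidiff D r f g := by
  rw [sharp_eq_finsum]
  refine finsum_eq_sum_of_support_subset _ fun r hr => ?_
  by_contra h
  exact hr (by simp [hN r (by simpa using h)])

lemma sharp_add_left (f f' g : Poly R) :
    sharp ħ D (f + f') g = sharp ħ D f g + sharp ħ D f' g := by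
  simp only [sharp_eq_finsum, bidiff_add_left, mul_add]
  exact finsum_add_distrib (hasFiniteSupport_sharp ..) (hasFiniteSupport_sharp ..)

lemma sharp_add_right (f g g' : Poly R) :
    sharp ħ D f (g + g') = sharp ħ D f g + sharp ħ D f g' := by
  simp only [sharp_eq_finsum, bidiff_add_right, mul_add]
  exact finsum_add_distrib (hasFiniteSupport_sharp ..) (hasFiniteSupport_sharp ..)

lemma sharp_casimir_mul_left {c : Poly R} (hc : IsCasimir c) (f g : Poly R) :
    sharp ħ D (c * f) g = c * sharp ħ D f g := by
  simp only [sharp_eq_finsum, bidiff_casimir_mul_left hc, mul_left_comm _ c]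
  exact (mul_finsum' _ _ (hasFiniteSupport_sharp ..)).symm

lemma sharp_casimir_mul_right {c : Poly R} (hc : IsCasimir c) (f g : Poly R) :
    sharp ħ D f (c * g) = c * sharp ħ D f g := by
  simp only [sharp_eq_finsum, bidiff_casimir_mul_right hc, mul_left_comm _ c]
  exact (mul_finsum' _ _ (hasFiniteSupport_sharp ..)).symm

@[simp] lemma sharp_zero_left (g : Poly R) : sharp ħ D 0 g = 0 := by simp [sharp_eq_finsum]

@[simp] lemma sharp_zero_right (f : Poly R) : sharp ħ D f 0 = 0 := by simp [sharp_eq_finsum]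

@[simp] lemma sharp_one_left (g : Poly R) : sharp ħ D 1 g = g := by
  rw [sharp_eq_sum (N := 1), Finset.sum_range_one, sharpCoeff_zero, bidiff, one_mul, one_mul]
  intro r hr g
  obtain ⟨r, rfl⟩ := Nat.exists_eq_add_of_le' hr
  simp [bidiff]

@[simp] lemma sharp_one_right (f : Poly R) : sharp ħ D f 1 = f := by
  rw [sharp_eq_finsum, finsum_eq_single _ 0, sharpCoeff_zero, bidiff, one_mul, mul_one]
  intro r hr
  obtain ⟨r, rfl⟩ := Nat.exists_eq_succ_of_ne_zero hr
  simp [bidiff]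

lemma sharp_casimir_left {c : Poly R} (hc : IsCasimir c) (f : Poly R) :
    sharp ħ D c f = c * f := by
  simpa using sharp_casimir_mul_left (ħ := ħ) (D := D) hc 1 f

lemma sharp_casimir_right {c : Poly R} (hc : IsCasimir c) (f : Poly R) :
    sharp ħ D f c = c * f := by
  simpa using sharp_casimir_mul_right (ħ := ħ) (D := D) hc f 1

lemma sharp_sum_left {ι : Type*} (s : Finset ι) (f : ι → Poly R) (g : Poly R) :
    sharp ħ D (∑ i ∈ s, f i) g = ∑ i ∈ s, sharp ħ D (f i) g :=
  map_sum (AddMonoidHom.mk' (sharp ħ D · g) fun f f' => sharp_add_left f f' g) f s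

lemma sharp_smul_right (c : ℂ) (f g : Poly R) : sharp ħ D f (c • g) = c • sharp ħ D f g := by
  rw [smul_eq_C_mul, smul_eq_C_mul, sharp_casimir_mul_right (isCasimir_C _)]

lemma dz_sharp (a : Fin 2) (f g : Poly R) :
    dz a (sharp ħ D f g) = sharp ħ D (dz a f) g + sharp ħ D f (dz a g) := by
  have hc : ∀ r, dz a (sharpCoeff ħ r) = 0 := fun r => by rw [sharpCoeff_eq_C, dz_C]
  simp only [sharp_eq_finsum]
  rw [← finsum_add_distrib (hasFiniteSupport_sharp ..) (hasFiniteSupport_sharp ..)]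
  refine ((dz a).toLinearMap.toAddMonoidHom.map_finsum (hasFiniteSupport_sharp ..)).trans
    (finsum_congr fun r => ?_)
  refine (dz_mul a _ _).trans ?_
  rw [hc, dz_bidiff, zero_mul, zero_add, mul_add]

lemma sharp_zc_mul (a : Fin 2) (f g : Poly R) :
    sharp ħ D (zc R a * f) g = zc R a * sharp ħ D f g +
      halfHbar ħ * ∑ b, piForm R D a b * sharp ħ D f (dz b g) := by
  obtain ⟨N, hN⟩ := exists_bidiff_eq_zero D f
  have h1 : ∀ r ≥ N + 1, ∀ g, bidiff D r (zc R a * f) g = 0 := fun r hr g => by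
    obtain ⟨r, rfl⟩ := Nat.exists_eq_add_of_le' (le_of_add_le_right hr)
    rw [bidiff_zc_mul, hN _ (by omega)]
    simp [hN r (by omega)]
  -- Both sums run to `N + 1`, so that after removal of the term `r = 0` they align with the sums to
  -- `N` for `f # ∂_b g`.
  rw [sharp_eq_sum h1, sharp_eq_sum (N := N + 1) (fun r hr => hN r (by omega)),
    Finset.sum_range_succ', Finset.sum_range_succ']
  have h2 : ∀ r, sharpCoeff ħ (r + 1) * bidiff D (r + 1) (zc R a * f) g =
      zc R a * (sharpCoeff ħ (r + 1) * bidiff D (r + 1) f g) +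
        halfHbar ħ * ∑ b, piForm R D a b * (sharpCoeff ħ r * bidiff D r f (dz b g)) := fun r => by
    simp only [mul_left_comm (piForm R D a _) (sharpCoeff ħ r), ← Finset.mul_sum]
    rw [bidiff_zc_mul, mul_add, ← mul_assoc (sharpCoeff ħ (r + 1)) (_ + _), sharpCoeff_succ]
    ring
  simp only [h2, Finset.sum_add_distrib, sharp_eq_sum hN, mul_add, ← Finset.mul_sum]
  rw [Finset.sum_comm]
  simp only [← Finset.mul_sum, bidiff, mul_left_comm (sharpCoeff ħ 0) (zc R a), mul_assoc]
  ring

lemma sharp_zc (a : Fin 2) (g : Poly R) :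
    sharp ħ D (zc R a) g = zc R a * g + halfHbar ħ * ∑ b, piForm R D a b * dz b g := by
  simpa using sharp_zc_mul (ħ := ħ) (D := D) a 1 g

/-- Left multiplication by `f` commutes with all right multiplications. -/
def LeftAssoc (ħ : R) (D : Matrix (Fin 2 × Fin 2) (Fin 2 × Fin 2) ℂ) (f : Poly R) : Prop :=
  ∀ g h, sharp ħ D (sharp ħ D f g) h = sharp ħ D f (sharp ħ D g h)

/-- Both sides equal `z_a (g # h)` plus `ħ/2` times the contraction of `P_ab` with `∂_b (g # h)`,
the latter expanded by the Leibniz rule. -/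
lemma leftAssoc_zc (a : Fin 2) : LeftAssoc ħ D (zc R a) := fun g h => by
  rw [sharp_zc, sharp_zc, sharp_add_left, sharp_zc_mul,
    sharp_casimir_mul_left (isCasimir_halfHbar ħ), sharp_sum_left]
  simp only [sharp_casimir_mul_left (isCasimir_piForm D _ _), dz_sharp, mul_add,
    Finset.sum_add_distrib]
  ring

lemma LeftAssoc.add {f f' : Poly R} (hf : LeftAssoc ħ D f) (hf' : LeftAssoc ħ D f') :
    LeftAssoc ħ D (f + f') := fun g h => by
  simp only [sharp_add_left, hf g h, hf' g h]

lemma LeftAssoc.casimir_mul {c f : Poly R} (hc : IsCasimir c) (hf : LeftAssoc ħ D f) :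
    LeftAssoc ħ D (c * f) := fun g h => by
  simp only [sharp_casimir_mul_left hc, hf g h]

lemma LeftAssoc.sum {ι : Type*} {s : Finset ι} {f : ι → Poly R} (hf : ∀ i, LeftAssoc ħ D (f i)) :
    LeftAssoc ħ D (∑ i ∈ s, f i) := fun g h => by
  simp only [sharp_sum_left, hf _ g h]

lemma LeftAssoc.sharp {f f' : Poly R} (hf : LeftAssoc ħ D f) (hf' : LeftAssoc ħ D f') :
    LeftAssoc ħ D (sharp ħ D f f') := fun g h => by
  rw [hf, hf, hf', hf]

lemma LeftAssoc.zc_mul {f : Poly R} (hf : LeftAssoc ħ D f) (hdf : ∀ b, LeftAssoc ħ D (dz b f))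
    (a : Fin 2) : LeftAssoc ħ D (zc R a * f) := by
  -- The correction term carries its sign as the Casimir `C (-1)`, so closure under negation is not
  -- needed.
  have h : zc R a * f = SharpTwistor.sharp ħ D (zc R a) f +
      C (-1) * (halfHbar ħ * ∑ b, piForm R D a b * dz b f) := by
    rw [sharp_zc]; simp
  rw [h]
  exact ((leftAssoc_zc a).sharp hf).add <| .casimir_mul (isCasimir_C _) <|
    .casimir_mul (isCasimir_halfHbar ħ) <| .sum fun b => (hdf b).casimir_mul (isCasimir_piForm D a b)

lemma leftAssoc_monomial (d : Fin 4 →₀ ℕ) (c : R) : LeftAssoc ħ D (monomial d c) := by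
  induction hn : d.degree using Nat.strong_induction_on generalizing d c with
  | _ n ih =>
    rcases eq_or_ne d 0 with rfl | hd
    · rw [← mul_one (monomial 0 c)]
      exact .casimir_mul (isCasimir_C c) fun g h => by simp
    obtain ⟨i, hi⟩ := Finsupp.ne_iff.1 hd
    obtain ⟨e, rfl⟩ : ∃ e, d = Finsupp.single i 1 + e :=
      exists_add_of_le (Finsupp.single_le_iff.2 (Nat.one_le_iff_ne_zero.2 hi))
    rw [map_add, Finsupp.degree_single] at hn
    rw [← one_mul c, ← monomial_mul]
    have he := ih e.degree (by omega) e c rfl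
    induction i using Fin.addCases (m := 2) (n := 2) with
    | left a =>
      refine he.zc_mul (fun b => ?_) a
      rw [dz, pderiv_monomial]
      -- Even where the subtraction truncates, the degree is at most that of `e`, which is below
      -- that of the original monomial.
      have := Finsupp.degree_mono (tsub_le_self : e - Finsupp.single (Fin.castAdd 2 b) 1 ≤ e)
      exact ih _ (by omega) _ _ rfl
    | right α => exact he.casimir_mul (isCasimir_pic α)

theorem sharp_assoc (f g h : Poly R) :
    sharp ħ D (sharp ħ D f g) h = sharp ħ D f (sharp ħ D g h) := by
  have : LeftAssoc ħ D f := by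
    induction f using MvPolynomial.induction_on' with
    | monomial d c => exact leftAssoc_monomial d c
    | add p q hp hq => exact hp.add hq
  exact this g h

lemma isHomogeneous_sharp {a b : ℕ} {f g : Poly R} (hf : f.IsHomogeneous a)
    (hg : g.IsHomogeneous b) : (sharp ħ D f g).IsHomogeneous (a + b) := by
  obtain ⟨N, hN⟩ := exists_bidiff_eq_zero D f
  rw [sharp_eq_sum hN]
  refine .sum _ _ _ fun r _ => ?_
  rw [sharpCoeff_eq_C]
  simpa using (isHomogeneous_C _ _).mul (isHomogeneous_bidiff D r hf hg)

lemma piForm_antisymm (hD : D.transpose = -D) (a b : Fin 2) :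
    piForm R D b a = -piForm R D a b := by
  have h : ∀ x y, D y x = -D x y := fun x y => congrFun (congrFun hD x) y
  rw [piForm, Finset.sum_comm, piForm, ← Finset.sum_neg_distrib]
  refine Finset.sum_congr rfl fun α _ => ?_
  rw [← Finset.sum_neg_distrib]
  refine Finset.sum_congr rfl fun β _ => ?_
  rw [h (α, a) (β, b), map_neg, C_neg]
  ring

/-- The products `z_a z_b` cancel, and antisymmetry makes the two first-order terms add up to twice
`ħ/2`. -/
lemma sharp_commutator (hD : D.transpose = -D) (a b : Fin 2) :
    sharp ħ D (zc R a) (zc R b) - sharp ħ D (zc R b) (zc R a) = C ħ * piForm R D a b := by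
  simp only [sharp_zc, dz_zc, mul_ite, mul_one, mul_zero, Finset.sum_ite_eq', Finset.mem_univ,
    if_true]
  rw [piForm_antisymm hD a b, ← two_mul_halfHbar]
  ring

/-! ### The exponential -/

lemma isHomogeneous_sharpPow {f : Poly R} {m : ℕ} (hf : f.IsHomogeneous m) (n : ℕ) :
    (sharpPow ħ D f n).IsHomogeneous (m * n) := by
  induction n with
  | zero => exact isHomogeneous_one _ _
  | succ n ih =>
    rw [mul_add, mul_one, add_comm (m * n)]
    exact isHomogeneous_sharp hf ih

lemma isHomogeneous_scaledSymbol (μ : Rˣ) {A : MvPolynomial (Fin 2) ℂ} {m : ℕ}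
    (hA : A.IsHomogeneous m) : (scaledSymbol μ A).IsHomogeneous m := by
  simpa [scaledSymbol] using (isHomogeneous_C _ _).mul ((hA.map _).rename_isHomogeneous)

lemma sharpExp_mul {f : Poly R} {m : ℕ} (hm : m ≠ 0) (hf : f.IsHomogeneous m) (t : ℂ) (n : ℕ) :
    sharpExp ħ D f t (m * n) = (t ^ n / (n.factorial : ℂ)) • sharpPow ħ D f n := by
  rw [sharpExp, finsum_eq_single _ n,
    homogeneousComponent_of_mem (isHomogeneous_sharpPow hf n), if_pos rfl]
  intro j hj
  rw [homogeneousComponent_of_mem (isHomogeneous_sharpPow hf j),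
    if_neg fun h => hj (Nat.eq_of_mul_eq_mul_left (Nat.pos_of_ne_zero hm) h).symm, smul_zero]

lemma sharpExp_of_not_dvd {f : Poly R} {m : ℕ} (hf : f.IsHomogeneous m) (t : ℂ) {k : ℕ}
    (hk : ¬ m ∣ k) : sharpExp ħ D f t k = 0 := by
  rw [sharpExp, ← finsum_zero (α := ℕ)]
  refine finsum_congr fun j => ?_
  rw [homogeneousComponent_of_mem (isHomogeneous_sharpPow hf j),
    if_neg fun h => hk ⟨j, h⟩, smul_zero]

lemma isHomogeneous_sharpExp {f : Poly R} (t : ℂ) (k : ℕ) :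
    (sharpExp ħ D f t k).IsHomogeneous k := by
  refine finsum_induction (IsHomogeneous · k) (isHomogeneous_zero _ _ _)
    (fun _ _ => IsHomogeneous.add) fun n => ?_
  rw [smul_eq_C_mul]
  simpa using (isHomogeneous_C _ _).mul (homogeneousComponent_isHomogeneous k _)

lemma sharpExp_zero {f : Poly R} {m : ℕ} (hm : m ≠ 0) (hf : f.IsHomogeneous m) (k : ℕ) :
    sharpExp ħ D f 0 k = if k = 0 then 1 else 0 := by
  by_cases hk : m ∣ k
  · obtain ⟨n, rfl⟩ := hk
    rw [sharpExp_mul hm hf]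
    rcases n with _ | n
    · simp [sharpPow]
    · simp [hm]
  · have h0 : k ≠ 0 := fun h => hk (h ▸ dvd_zero m)
    rw [sharpExp_of_not_dvd hf 0 hk, if_neg h0]

/-- Only the component of degree `m` of `f` is nonzero, so the graded convolution has at most one
term. -/
lemma sum_antidiagonal_sharp {f : Poly R} {m : ℕ} (hf : f.IsHomogeneous m) (F : ℕ → Poly R)
    (k : ℕ) :
    ∑ ij ∈ Finset.HasAntidiagonal.antidiagonal k,
        sharp ħ D (homogeneousComponent ij.1 f) (F ij.2) =
      if m ≤ k then sharp ħ D f (F (k - m)) else 0 := by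
  simp only [homogeneousComponent_of_mem hf]
  split_ifs with h
  · rw [Finset.sum_eq_single (m, k - m), if_pos rfl]
    · rintro ⟨i, j⟩ hij hne
      rw [if_neg, sharp_zero_left]
      rintro rfl
      refine hne (Prod.ext rfl ?_)
      have := Finset.HasAntidiagonal.mem_antidiagonal.1 hij
      simp only at this ⊢
      omega
    · intro h'
      exact absurd (Finset.HasAntidiagonal.mem_antidiagonal.2 (Nat.add_sub_cancel' h)) h'
  · refine Finset.sum_eq_zero fun ij hij => ?_
    have := Finset.HasAntidiagonal.mem_antidiagonal.1 hij
    rw [if_neg (by omega), sharp_zero_left]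

lemma hasDerivAt_sharpExp {f : Poly R} {m : ℕ} (hm : m ≠ 0) (hf : f.IsHomogeneous m)
    (t : ℂ) (k : ℕ) (φ : Poly R →ₗ[ℂ] ℂ) :
    HasDerivAt (fun s => φ (sharpExp ħ D f s k))
      (φ (∑ ij ∈ Finset.HasAntidiagonal.antidiagonal k,
        sharp ħ D (homogeneousComponent ij.1 f) (sharpExp ħ D f t ij.2))) t := by
  rw [sum_antidiagonal_sharp hf]
  by_cases hk : m ∣ k
  · obtain ⟨n, rfl⟩ := hk
    simp only [sharpExp_mul hm hf, map_smul, smul_eq_mul]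
    rcases n with _ | n
    -- The component of degree zero is constant in `t`, and no product with `f` reaches it because
    -- `m > 0`.
    · rw [if_neg (by omega)]
      simpa using hasDerivAt_const t _
    · rw [if_pos (Nat.le_mul_of_pos_right m n.succ_pos),
        show m * (n + 1) - m = m * n by rw [mul_add, mul_one, Nat.add_sub_cancel],
        sharpExp_mul hm hf, sharp_smul_right, map_smul, smul_eq_mul]
      refine HasDerivAt.mul_const ?_ _
      -- `f^{#(n+1)}` is `f # f^{#n}` by definition, so only the derivative of `t^(n+1)/(n+1)!`
      -- remains.
      convert (hasDerivAt_pow (n + 1) t).div_const ((n + 1).factorial : ℂ) using 1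
      have h1 : ((n : ℂ) + 1) ≠ 0 := Nat.cast_add_one_ne_zero n
      have h2 : (n.factorial : ℂ) ≠ 0 := Nat.cast_ne_zero.2 n.factorial_ne_zero
      rw [Nat.factorial_succ]
      push_cast
      field_simp
  · have h0 : (if m ≤ k then sharp ħ D f (sharpExp ħ D f t (k - m)) else 0) = 0 := by
      split_ifs with h
      · rw [sharpExp_of_not_dvd hf t fun h' => hk ((Nat.dvd_sub_iff_left h dvd_rfl).1 h'),
          sharp_zero_right]
      · rfl
    simp only [sharpExp_of_not_dvd hf _ hk, h0, map_zero]
    exact hasDerivAt_const t _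

end Sharp

section Cohomology

variable {R : Type} [CommRing R] [Algebra ℂ R]

/-! ### Cohomology classes from homogeneous polynomials -/

lemma eval_smul_of_isHomogeneous {k : ℕ} {p : Poly R} (hp : p.IsHomogeneous k) (c : ℂ) (v : Vec) :
    eval (fun i => algebraMap ℂ R ((c • v) i)) p =
      c ^ k • eval (fun i => algebraMap ℂ R (v i)) p := by
  rw [eval_eq, eval_eq, Finset.smul_sum]
  refine Finset.sum_congr rfl fun d hd => ?_
  have hdeg : ∑ i, d i = k := by
    rw [← Finsupp.degree_eq_sum]
    rw [Finsupp.degree_eq_weight_one]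
    exact hp (mem_support_iff.1 hd)
  simp only [Pi.smul_apply, smul_eq_mul, map_mul, mul_pow, Finset.prod_mul_distrib]
  rw [Finset.prod_subset (Finset.subset_univ d.support), Finset.prod_pow_eq_pow_sum, hdeg,
    ← map_pow, Algebra.smul_def]
  · ring
  · intro i _ hi
    rw [Finsupp.notMem_support_iff.1 hi, pow_zero]

lemma twistPrelocal_eval {k : ℕ} {p : Poly R} (hp : p.IsHomogeneous k) (U : Opens CP3) :
    (twistPrelocal R (k : ℤ)).pred (U := U)
      (fun _ v => eval (fun i => algebraMap ℂ R (v.1 i)) p) := by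
  -- One holomorphic function per monomial of `p`, weighted by its coefficient in `R`.
  refine ⟨fun p c v => ?_, p.support.card,
    fun j v => ∏ i, v i ^ (p.support.equivFin.symm j).1 i,
    fun j => coeff (p.support.equivFin.symm j).1 p, fun j => ?_, fun _ v => ?_⟩
  · rw [zpow_natCast]
    exact eval_smul_of_isHomogeneous hp _ _
  · simp only [Fin.prod_univ_four]
    fun_prop
  · beta_reduce
    rw [eval_eq', ← Finset.sum_coe_sort, ← p.support.equivFin.symm.sum_comp]
    refine Finset.sum_congr rfl fun j _ => ?_
    rw [Algebra.smul_def, map_prod, mul_comm]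
    simp only [map_pow]

/-- The global section of `𝒪(k) ⊗ R` given by a homogeneous polynomial of degree `k`. -/
def polySection {k : ℕ} {p : Poly R} (hp : p.IsHomogeneous k) : twistSections R (k : ℤ) ⊤ :=
  ⟨fun _ v => eval (fun i => algebraMap ℂ R (v.1 i)) p,
    TopCat.PrelocalPredicate.sheafifyOf (twistPrelocal_eval hp ⊤)⟩

/-- Classes in degree zero of a product of sheaves are given by their components. -/
lemma existsUnique_H_pi {C : Type*} [Category* C] {J : GrothendieckTopology C}
    [HasSheafify J AddCommGrpCat.{0}] [HasExt.{0} (Sheaf J AddCommGrpCat.{0})]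
    {ι : Type*} (F : ι → Sheaf J AddCommGrpCat.{0}) [HasProduct F] (s : ∀ i, Sheaf.H (F i) 0) :
    ∃! c : Sheaf.H (∏ᶜ F) 0, ∀ i, Sheaf.H.map (Pi.π F i) 0 c = s i := by
  -- Degree-zero classes are morphisms into the coefficient sheaf, so the universal property of the
  -- product gives existence and uniqueness.
  refine ⟨Abelian.Ext.addEquiv₀.symm (Pi.lift fun k => Abelian.Ext.addEquiv₀ (s k)),
    fun k => ?_, fun c hc => ?_⟩
  · apply Abelian.Ext.addEquiv₀.injective
    rw [Sheaf.H.addEquiv₀_map, AddEquiv.apply_symm_apply, Pi.lift_π]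
  · rw [AddEquiv.eq_symm_apply]
    refine Pi.hom_ext _ _ fun k => ?_
    rw [Pi.lift_π, ← hc k, Sheaf.H.addEquiv₀_map]

lemma globalSection_bijective (k : ℤ) :
    Function.Bijective (globalSection : Sheaf.H (twist R k) 0 → twistSections R k ⊤) :=
  EquivLike.bijective (Sheaf.H.equiv₀ (twist R k) isTerminalTop)

/-- Every point of a punctured line is a nonzero vector, so the values determine the global section
and hence the class. -/
lemma classValue_ext {k : ℤ} {c c' : Sheaf.H (twist R k) 0}
    (h : ∀ v hv, classValue c v hv = classValue c' v hv) : c = c' := by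
  have hval : ∀ (p : CP3) (hp : p ∈ (⊤ : Opens CP3)) (v : Line p),
      (globalSection c).1 ⟨p, hp⟩ v = (globalSection c').1 ⟨p, hp⟩ v := by
    rintro _ _ ⟨v, hv, rfl⟩
    exact h v hv
  exact (globalSection_bijective k).1 (Subtype.ext (funext fun p => funext fun v => hval p.1 p.2 v))

lemma existsUnique_class (p : ℕ → Poly R) (hp : ∀ k, (p k).IsHomogeneous k) :
    ∃! c : Sheaf.H (coeffSheaf R) 0, ∀ (k : ℕ) (v : Vec) (hv : v ≠ 0),
      classValue (Sheaf.H.map (coeffProj R k) 0 c) v hv =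
        eval (fun i => algebraMap ℂ R (v i)) (p k) := by
  choose s hs using fun k : ℕ => (globalSection_bijective (k : ℤ)).2 (polySection (hp k))
  have hs' (k : ℕ) (v : Vec) (hv : v ≠ 0) :
      classValue (s k) v hv = eval (fun i => algebraMap ℂ R (v i)) (p k) := by
    rw [classValue, hs]
    rfl
  obtain ⟨c, hc, huniq⟩ := existsUnique_H_pi (fun k : ℕ => twist R (k : ℤ)) s
  refine ⟨c, fun k v hv => ?_, fun c' hc' => huniq c' fun k => ?_⟩
  · rw [← hs' k v hv, ← hc k]
    rfl
  · exact classValue_ext fun v hv => (hc' k v hv).trans (hs' k v hv).symm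

end Cohomology

end SharpTwistor

end

theorem mainTheorem6 (R : Type) [CommRing R] [Algebra ℂ R] (ħ : R) (μ : Rˣ)
    (D : Matrix (Fin 2 × Fin 2) (Fin 2 × Fin 2) ℂ) (hD : D.transpose = -D)
    (A : MvPolynomial (Fin 2) ℂ) (hA : A.IsHomogeneous 2) :
    -- the sharp product is an associative, unital, biadditive product
    (∀ f g h : SharpTwistor.Poly R, SharpTwistor.sharp ħ D (SharpTwistor.sharp ħ D f g) h =
      SharpTwistor.sharp ħ D f (SharpTwistor.sharp ħ D g h)) ∧
    (∀ f : SharpTwistor.Poly R,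
      SharpTwistor.sharp ħ D 1 f = f ∧ SharpTwistor.sharp ħ D f 1 = f) ∧
    (∀ f g h : SharpTwistor.Poly R,
      SharpTwistor.sharp ħ D (f + g) h =
        SharpTwistor.sharp ħ D f h + SharpTwistor.sharp ħ D g h ∧
      SharpTwistor.sharp ħ D f (g + h) =
        SharpTwistor.sharp ħ D f g + SharpTwistor.sharp ħ D f h) ∧
    -- it is compatible with the twists
    (∀ (a b : ℕ) (f g : SharpTwistor.Poly R), f.IsHomogeneous a → g.IsHomogeneous b →
      (SharpTwistor.sharp ħ D f g).IsHomogeneous (a + b)) ∧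
    -- its commutation relations
    (∀ a b : Fin 2,
      SharpTwistor.sharp ħ D (SharpTwistor.zc R a) (SharpTwistor.zc R b) -
        SharpTwistor.sharp ħ D (SharpTwistor.zc R b) (SharpTwistor.zc R a) =
      MvPolynomial.C ħ * ∑ α, ∑ β, MvPolynomial.C (algebraMap ℂ R (D (α, a) (β, b))) *
        SharpTwistor.pic R α * SharpTwistor.pic R β) ∧
    (∀ (α : Fin 2) (f : SharpTwistor.Poly R),
      SharpTwistor.sharp ħ D (SharpTwistor.pic R α) f = SharpTwistor.pic R α * f ∧
      SharpTwistor.sharp ħ D f (SharpTwistor.pic R α) = SharpTwistor.pic R α * f) ∧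
    -- each degree receives only finitely many terms of the exponential series
    (∀ n : ℕ, (SharpTwistor.sharpPow ħ D (SharpTwistor.scaledSymbol μ A) n).IsHomogeneous
      (2 * n)) ∧
    -- the exponential solves the evolution equation with initial value one
    (∀ k : ℕ, SharpTwistor.sharpExp ħ D (SharpTwistor.scaledSymbol μ A) 0 k =
      if k = 0 then 1 else 0) ∧
    (∀ (t : ℂ) (k : ℕ) (d : Fin 4 →₀ ℕ) (φ : R →ₗ[ℂ] ℂ),
      HasDerivAt
        (fun s : ℂ => φ (MvPolynomial.coeff d
          (SharpTwistor.sharpExp ħ D (SharpTwistor.scaledSymbol μ A) s k)))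
        (φ (MvPolynomial.coeff d (∑ ij ∈ Finset.HasAntidiagonal.antidiagonal k,
          SharpTwistor.sharp ħ D
            (MvPolynomial.homogeneousComponent ij.1 (SharpTwistor.scaledSymbol μ A))
            (SharpTwistor.sharpExp ħ D (SharpTwistor.scaledSymbol μ A) t ij.2)))) t) ∧
    -- the exponential is a cohomology class with coefficients in the formal sum of the twists
    (∃! c : CategoryTheory.Sheaf.H (SharpTwistor.coeffSheaf R) 0,
      ∀ (k : ℕ) (v : SharpTwistor.Vec) (hv : v ≠ 0),
        SharpTwistor.classValue
            (CategoryTheory.Sheaf.H.map (SharpTwistor.coeffProj R k) 0 c) v hv =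
          MvPolynomial.eval (fun i => algebraMap ℂ R (v i))
            (SharpTwistor.sharpExp ħ D (SharpTwistor.scaledSymbol μ A) 1 k)) := by
  have hS := SharpTwistor.isHomogeneous_scaledSymbol μ hA
  refine ⟨SharpTwistor.sharp_assoc, fun f =>
      ⟨SharpTwistor.sharp_one_left f, SharpTwistor.sharp_one_right f⟩,
    fun f g h => ⟨SharpTwistor.sharp_add_left f g h, SharpTwistor.sharp_add_right f g h⟩,
    fun a b f g => SharpTwistor.isHomogeneous_sharp, SharpTwistor.sharp_commutator hD,
    fun α f => ⟨SharpTwistor.sharp_casimir_left (SharpTwistor.isCasimir_pic α) f,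
      SharpTwistor.sharp_casimir_right (SharpTwistor.isCasimir_pic α) f⟩,
    SharpTwistor.isHomogeneous_sharpPow hS, SharpTwistor.sharpExp_zero two_ne_zero hS,
    fun t k d φ => ?_,
    SharpTwistor.existsUnique_class _ fun k => SharpTwistor.isHomogeneous_sharpExp 1 k⟩
  -- Taking the coefficient at `d` and then `φ` is one `ℂ`-linear functional on polynomials.
  exact SharpTwistor.hasDerivAt_sharpExp two_ne_zero hS t k
    (φ ∘ₗ (MvPolynomial.lcoeff R d).restrictScalars ℂ)
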